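/- Let $\mathcal{C}$ be a circle in the plane with center $O$, and let $\mathcal{E}_c$ be a (nondegenerate) ellipse contained in the open disk bounded by $\mathcal{C}$. Let $\mathcal{T}$ be the Poncelet family of all triangles inscribed in $\mathcal{C}$ whose three sidelines are tangent to $\mathcal{E}_c$, and suppose that $\mathcal{T}$ contains an equilateral triangle. The tangential triangle $T'$ of a triangle $T\in\mathcal{T}$ is the triangle whose sidelines are the tangents to $\mathcal{C}$ at the vertices of $T$. The Feuerbach point $X_{11}$ of a non-equilateral triangle is the point where its incircle touches its nine-point circle; the center $X_{110}$ of a non-equilateral triangle with sidelengths $a,b,c$ is the point with barycentric coordinates $\frac{a^2}{b^2-c^2}:\frac{b^2}{c^2-a^2}:\frac{c^2}{a^2-b^2}$ (after clearing denominators). Then: 1. The family of tangential triangles $T'$, $T\in\mathcal{T}$, contains an equilateral triangle. 2. If $O$ lies in the interior of $\mathcal{E}_c$, then every triangle of $\mathcal{T}$ is acute. 3. There is a point $K\in\mathcal{C}$ such that for every acute $T\in\mathcal{T}$ the tangential triangle $T'$ exists, its incircle is $\mathcal{C}$, and, unless $T'$ is equilateral, $X_{11}(T')=K=X_{110}(T)$.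 In particular, if $O$ lies in the interior of $\mathcal{E}_c$, then all tangential triangles circumscribe $\mathcal{C}$ and their Feuerbach point is stationary. -/

import Mathlib

open EuclideanGeometry

noncomputable section

/-- The ellipse with foci `f`, `g` and major axis of length `2 * a`
(nondegenerate exactly when `dist f g < 2 * a`; a circle when `f = g`). -/
def ellipse (f g : ℂ) (a : ℝ) : Set ℂ :=
  {z | dist z f + dist z g = 2 * a}

/-- The line carrying the side of the triangle `T` opposite to the vertex `i`. -/
def sideline (T : Affine.Triangle ℝ ℂ) (i : Fin 3) : AffineSubspace ℝ ℂ :=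
  affineSpan ℝ (Set.range (T.faceOpposite i).points)

/-- A line is tangent to a (nondegenerate) ellipse when they have exactly one common point. -/
def IsTangentToEllipse (l : AffineSubspace ℝ ℂ) (E : Set ℂ) : Prop :=
  ∃! z, z ∈ l ∧ z ∈ E

/-- The Poncelet family of triangles inscribed in the circle `S` and circumscribing
the ellipse `E`. -/
def ponceletFamily (S : Sphere ℂ) (E : Set ℂ) : Set (Affine.Triangle ℝ ℂ) :=
  {T | (∀ i, T.points i ∈ S) ∧ ∀ i, IsTangentToEllipse (sideline T i) E}

/-- `T'` is the tangential triangle of `T`: its sidelines are the tangents to the circumcircle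
of `T` at the vertices of `T`. -/
def IsTangentialTriangle (T T' : Affine.Triangle ℝ ℂ) : Prop :=
  ∀ i, T.circumsphere.IsTangentAt (T.points i) (sideline T' i)

/-- `P` is the Feuerbach point `X₁₁` of `T`: the incircle and the nine-point circle of `T` are
different circles (they coincide only for an equilateral triangle, which has no Feuerbach point)
and the former touches the latter internally at `P`. -/
def IsFeuerbachPoint (T : Affine.Triangle ℝ ℂ) (P : ℂ) : Prop :=
  T.insphere ≠ T.ninePointCircle ∧ T.insphere.IsIntTangentAt T.ninePointCircle P

/-- The triangle center `X₁₁₀`, with barycentric coordinates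
`a²/(b²-c²) : b²/(c²-a²) : c²/(a²-b²)`. The denominators are cleared, so that isosceles triangles
are covered; the sum of the weights vanishes only for equilateral triangles. -/
def x110 (T : Affine.Triangle ℝ ℂ) : ℂ :=
  let a := dist (T.points 1) (T.points 2)
  let b := dist (T.points 2) (T.points 0)
  let c := dist (T.points 0) (T.points 1)
  let u : ℝ := a ^ 2 * (c ^ 2 - a ^ 2) * (a ^ 2 - b ^ 2)
  let v : ℝ := b ^ 2 * (a ^ 2 - b ^ 2) * (b ^ 2 - c ^ 2)
  let w : ℝ := c ^ 2 * (b ^ 2 - c ^ 2) * (c ^ 2 - a ^ 2)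
  (u * T.points 0 + v * T.points 1 + w * T.points 2) / (u + v + w)

end

/-! ### Tangent lines of an ellipse given by its foci -/

section Ellipse

/-! Normalise the circle to the unit circle (`unitCoord`). Let x, y, w be the vertices, e₁, e₂, e₃
their elementary symmetric functions, F, G the foci. Conjugation inverts points of the circle, so
conj e₁ = e₂/e₃.

For a tangent of an ellipse, the product of the signed distances from the foci is the squared minor
semiaxis (`IsTangentToEllipse.im_mul_im_eq`). For a chord xy this is an equation quadratic in each
endpoint (`chord_tangency`), and two uses of Vieta yield e₁ = F + G + e₃·F̄Ḡ
(`sum_eq_of_chord_tangency`). The equilateral member has e₁ = 0 and some product e₃ = l₀.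
Subtracting, e₁ = (e₃ - l₀)F̄Ḡ, and conjugating, e₂ = -(e₃ - l₀)FG/l₀. So K = e₂/e₁ = -FG/(l₀F̄Ḡ) is
the same unimodular number for the whole family.

This quotient is the required point. For an acute triangle h = |e₁| < 1, the incircle of the
tangential triangle is the unit circle, and its nine-point circle has centre -h²/(1 - h²)·K and
radius 1/(1 - h²), hence touches the incircle at K (`IsTangentialTriangle.ninePointCircle_eq`). The
barycentric formula for X₁₁₀ also evaluates to e₂/e₁ (`x110_eq`). Acuteness when O is inside the
ellipse is a convexity argument (`inner_pos_of_center_inside`). -/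

theorem sideline_eq (T : Affine.Triangle ℝ ℂ) (i : Fin 3) :
    sideline T i = line[ℝ, T.points (i + 1), T.points (i + 2)] := by
  have hc : ({i}ᶜ : Set (Fin 3)) = {i + 1, i + 2} := by
    ext j
    simp only [Set.mem_compl_iff, Set.mem_singleton_iff, Set.mem_insert_iff]
    decide +revert
  simp [sideline, Affine.Simplex.range_faceOpposite_points, hc, Set.image_insert_eq]

/-- If two complex numbers are separated by the real axis, the segment between them meets it. -/
theorem exists_real_norm_sub_add_norm_sub_eq (F G : ℂ) (h : F.im * G.im ≤ 0) :
    ∃ τ : ℝ, ‖(τ : ℂ) - F‖ + ‖(τ : ℂ) - G‖ = ‖F - G‖ := by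
  by_cases hFG : F.im = G.im
  · have hF : F.im = 0 := by
      rw [← hFG] at h
      nlinarith
    refine ⟨F.re, ?_⟩
    have : ((F.re : ℝ) : ℂ) = F := Complex.ext (by simp) (by simp [hF])
    simp [this]
  · set s : ℝ := F.im / (F.im - G.im) with hs
    have hne : F.im - G.im ≠ 0 := sub_ne_zero.2 hFG
    have hpos : 0 < (F.im - G.im) ^ 2 := by positivity
    have hs' : s = F.im * (F.im - G.im) / (F.im - G.im) ^ 2 := by rw [hs]; field_simp
    have hs0 : 0 ≤ s := by
      rw [hs']
      apply div_nonneg _ hpos.le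
      nlinarith [sq_nonneg F.im]
    have hs1 : s ≤ 1 := by
      rw [hs', div_le_one hpos]
      nlinarith [sq_nonneg G.im]
    have hτ : (((F + (s : ℂ) * (G - F)).re : ℝ) : ℂ) = F + (s : ℂ) * (G - F) := by
      apply Complex.ext
      · simp
      · have : F.im + s * (G.im - F.im) = 0 := by rw [hs]; field_simp; ring
        simp [this]
    refine ⟨(F + (s : ℂ) * (G - F)).re, ?_⟩
    rw [hτ, show F + (s : ℂ) * (G - F) - F = ((-s : ℝ) : ℂ) * (F - G) by push_cast; ring,
      show F + (s : ℂ) * (G - F) - G = ((1 - s : ℝ) : ℂ) * (F - G) by push_cast; ring,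
      norm_mul, norm_mul, Complex.norm_real, Complex.norm_real, Real.norm_eq_abs,
      Real.norm_eq_abs, abs_neg, abs_of_nonneg hs0, abs_of_nonneg (by linarith)]
    ring

/-- If `k` is the minimum over the real axis of the sum of the distances to `F` and `G`, and it
exceeds the distance between them, then the product of the ordinates of `F` and `G` is the square
of the minor semiaxis of the corresponding ellipse. -/
theorem four_mul_im_mul_im_eq {F G : ℂ} {k : ℝ}
    (hle : ∀ τ : ℝ, k ≤ ‖(τ : ℂ) - F‖ + ‖(τ : ℂ) - G‖)
    (heq : ∃ τ : ℝ, ‖(τ : ℂ) - F‖ + ‖(τ : ℂ) - G‖ = k) (hk : ‖F - G‖ < k) :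
    4 * (F.im * G.im) = k ^ 2 - ‖F - G‖ ^ 2 := by
  have hconj : ∀ τ : ℝ, ‖(τ : ℂ) - (starRingEnd ℂ) G‖ = ‖(τ : ℂ) - G‖ := fun τ ↦ by
    rw [← Complex.norm_conj]; simp
  rcases le_or_gt (F.im * G.im) 0 with h | h
  · obtain ⟨τ, hτ⟩ := exists_real_norm_sub_add_norm_sub_eq F G h
    linarith [hle τ]
  -- Foci on the same side: reflecting G in the axis keeps distances to real points, so the minimum
  -- is the distance from F to the mirror image of G.
  · obtain ⟨τ, hτ⟩ := exists_real_norm_sub_add_norm_sub_eq F ((starRingEnd ℂ) G)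
      (by simp; linarith)
    obtain ⟨τ₀, hτ₀⟩ := heq
    have h₁ : k ≤ ‖F - (starRingEnd ℂ) G‖ := by
      rw [← hτ, hconj]; exact hle τ
    have h₂ : ‖F - (starRingEnd ℂ) G‖ ≤ k := by
      rw [← hτ₀, ← hconj, norm_sub_rev (τ₀ : ℂ) F]
      exact norm_sub_le_norm_sub_add_norm_sub _ _ _
    rw [le_antisymm h₁ h₂, ← Complex.normSq_eq_norm_sq, ← Complex.normSq_eq_norm_sq,
      Complex.normSq_apply, Complex.normSq_apply]
    simp
    ring

variable {P Q f g : ℂ} {a : ℝ}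

/-- A point of the line strictly inside the ellipse would force, by the intermediate value theorem
on both sides of it, two common points instead of one. -/
theorem IsTangentToEllipse.two_mul_le_dist_add_dist (hPQ : P ≠ Q)
    (h : IsTangentToEllipse line[ℝ, P, Q] (ellipse f g a)) {z : ℂ} (hz : z ∈ line[ℝ, P, Q]) :
    2 * a ≤ dist z f + dist z g := by
  by_contra! hlt
  obtain ⟨t₁, rfl⟩ := (mem_affineSpan_pair_iff_exists_lineMap_eq).1 hz
  set c : ℝ → ℂ := fun t ↦ AffineMap.lineMap P Q t with hc
  have hcont : Continuous fun t ↦ dist (c t) f + dist (c t) g := by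
    have : Continuous c := AffineMap.lineMap_continuous
    fun_prop
  have hinj : Function.Injective c := AffineMap.lineMap_injective ℝ hPQ
  have hd : 0 < dist P Q := dist_pos.2 hPQ
  have hmem : ∀ t, c t ∈ line[ℝ, P, Q] := fun t ↦ AffineMap.lineMap_mem_affineSpan_pair _ _ _
  -- At parameter distance `M` from `t₁` the distance to `f` alone is already at least `2 * a`.
  set M : ℝ := (2 * a + dist (c t₁) f) / dist P Q with hM
  have ha : 0 < 2 * a := lt_of_le_of_lt (by positivity) hlt
  have hM0 : 0 < M := by positivity
  have hfar : ∀ t, |t - t₁| = M → 2 * a ≤ dist (c t) f + dist (c t) g := by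
    intro t ht
    have h1 : dist (c t) (c t₁) = M * dist P Q := by
      rw [hc]; simp only [dist_lineMap_lineMap, Real.dist_eq, ht]
    rw [hM, div_mul_cancel₀ _ hd.ne'] at h1
    have h2 := dist_triangle_right (c t) (c t₁) f
    linarith [dist_nonneg (x := c t) (y := g)]
  obtain ⟨s, ⟨hs1, hs2⟩, hs⟩ := intermediate_value_Icc (by linarith : t₁ ≤ t₁ + M)
    hcont.continuousOn ⟨hlt.le, hfar (t₁ + M) (by simp [hM0.le])⟩
  obtain ⟨r, ⟨hr1, hr2⟩, hr⟩ := intermediate_value_Icc' (by linarith : t₁ - M ≤ t₁)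
    hcont.continuousOn ⟨hlt.le, hfar (t₁ - M) (by simp [hM0.le])⟩
  have hrs : r = s := hinj (h.unique ⟨hmem r, hr⟩ ⟨hmem s, hs⟩)
  have : s = t₁ := le_antisymm (hrs ▸ hr2) hs1
  subst this
  exact hlt.ne hs

/-- Multiplication by `conj (Q - P)` turns the line into the real axis and scales lengths by `‖Q -
P‖`; the imaginary parts are the scaled signed distances of the foci from the tangent. -/
theorem IsTangentToEllipse.im_mul_im_eq (hPQ : P ≠ Q) (ha : dist f g < 2 * a)
    (h : IsTangentToEllipse line[ℝ, P, Q] (ellipse f g a)) :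
    4 * (((f - P) * (starRingEnd ℂ) (Q - P)).im * ((g - P) * (starRingEnd ℂ) (Q - P)).im) =
      ((2 * a) ^ 2 - dist f g ^ 2) * ‖Q - P‖ ^ 2 := by
  have hd : 0 < ‖Q - P‖ := norm_pos_iff.2 (sub_ne_zero.2 hPQ.symm)
  have key : ∀ (t : ℝ) (w : ℂ),
      ‖((t * ‖Q - P‖ ^ 2 : ℝ) : ℂ) - (w - P) * (starRingEnd ℂ) (Q - P)‖ =
        dist (AffineMap.lineMap P Q t) w * ‖Q - P‖ := by
    intro t w
    rw [dist_eq_norm, ← Complex.norm_conj (Q - P), ← norm_mul]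
    congr 1
    have := Complex.mul_conj' (Q - P)
    rw [AffineMap.lineMap_apply]
    simp only [Complex.norm_conj, vsub_eq_sub, vadd_eq_add, Complex.real_smul]
    push_cast
    linear_combination -(t : ℂ) * this
  have hFG : ‖(f - P) * (starRingEnd ℂ) (Q - P) - (g - P) * (starRingEnd ℂ) (Q - P)‖ =
      dist f g * ‖Q - P‖ := by
    rw [← sub_mul, norm_mul, Complex.norm_conj, dist_eq_norm, sub_sub_sub_cancel_right]
  rw [four_mul_im_mul_im_eq (k := 2 * a * ‖Q - P‖), hFG]
  · ring
  · intro τ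
    have h1 := key (τ / ‖Q - P‖ ^ 2) f
    have h2 := key (τ / ‖Q - P‖ ^ 2) g
    rw [div_mul_cancel₀ _ (by positivity)] at h1 h2
    rw [h1, h2, ← add_mul]
    exact mul_le_mul_of_nonneg_right
      (h.two_mul_le_dist_add_dist hPQ (AffineMap.lineMap_mem_affineSpan_pair _ _ _)) hd.le
  · obtain ⟨z, ⟨hz, hzE⟩, -⟩ := h
    obtain ⟨t, rfl⟩ := (mem_affineSpan_pair_iff_exists_lineMap_eq).1 hz
    refine ⟨t * ‖Q - P‖ ^ 2, ?_⟩
    rw [key, key, ← add_mul]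
    congr 1
  · rw [hFG]
    exact mul_lt_mul_of_pos_right ha hd

end Ellipse

/-! ### The tangency equation for chords of the unit circle and its Vieta relations -/

section Poncelet

open ComplexConjugate

theorem conj_eq_inv_of_norm_eq_one {x : ℂ} (hx : ‖x‖ = 1) : conj x = x⁻¹ :=
  (Complex.inv_eq_conj hx).symm

theorem ne_zero_of_norm_eq_one {x : ℂ} (hx : ‖x‖ = 1) : x ≠ 0 := by
  rintro rfl; simp at hx

theorem ofReal_norm_sub_sq {x y : ℂ} (hx : ‖x‖ = 1) (hy : ‖y‖ = 1) :
    ((‖x - y‖ ^ 2 : ℝ) : ℂ) = -(x - y) ^ 2 / (x * y) := by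
  have := ne_zero_of_norm_eq_one hx
  have := ne_zero_of_norm_eq_one hy
  rw [Complex.ofReal_pow, ← Complex.mul_conj', map_sub, conj_eq_inv_of_norm_eq_one hx,
    conj_eq_inv_of_norm_eq_one hy]
  field_simp
  ring

/-- The tangency condition for the chord `xy` of the unit circle and an ellipse with foci
`f`, `g`, in complex coordinates. -/
theorem chord_tangency {x y f g : ℂ} {κ : ℝ} (hx : ‖x‖ = 1) (hy : ‖y‖ = 1) (hxy : x ≠ y)
    (h : 4 * (((f - x) * conj (y - x)).im * ((g - x) * conj (y - x)).im) = κ * ‖y - x‖ ^ 2) :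
    (f + x * y * conj f - x - y) * (g + x * y * conj g - x - y) = κ * (x * y) := by
  have hx0 := ne_zero_of_norm_eq_one hx
  have hy0 := ne_zero_of_norm_eq_one hy
  have key : ∀ w : ℂ, (((w - x) * conj (y - x)).im : ℂ) * (2 * Complex.I) =
      (x - y) / (x * y) * (w + x * y * conj w - x - y) := by
    intro w
    have h1 := Complex.sub_conj ((w - x) * conj (y - x))
    rw [mul_comm, mul_assoc, mul_comm Complex.I, ← mul_assoc]
    push_cast at h1
    rw [← h1]
    simp only [map_mul, map_sub, Complex.conj_conj]
    rw [conj_eq_inv_of_norm_eq_one hx, conj_eq_inv_of_norm_eq_one hy]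
    field_simp
    ring
  have h2 : (4 : ℂ) * ((((f - x) * conj (y - x)).im : ℂ) * (((g - x) * conj (y - x)).im : ℂ)) =
      κ * ((‖y - x‖ ^ 2 : ℝ) : ℂ) := by
    exact_mod_cast congrArg (fun r : ℝ ↦ (r : ℂ)) h
  rw [ofReal_norm_sub_sq hy hx] at h2
  have hf := key f
  have hg := key g
  have h3 : ((x - y) / (x * y)) ^ 2 *
      ((f + x * y * conj f - x - y) * (g + x * y * conj g - x - y)) =
      ((x - y) / (x * y)) ^ 2 * (κ * (x * y)) := by
    calc _ = ((x - y) / (x * y) * (f + x * y * conj f - x - y)) *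
          ((x - y) / (x * y) * (g + x * y * conj g - x - y)) := by ring
      _ = -(4 * ((((f - x) * conj (y - x)).im : ℂ) * (((g - x) * conj (y - x)).im : ℂ))) := by
          rw [← hf, ← hg]
          linear_combination 4 * (((f - x) * conj (y - x)).im : ℂ) *
            (((g - x) * conj (y - x)).im : ℂ) * Complex.I_sq
      _ = _ := by rw [h2]; field_simp; ring
  exact mul_left_cancel₀ (pow_ne_zero 2 (div_ne_zero (sub_ne_zero.2 hxy)
    (mul_ne_zero hx0 hy0))) h3

theorem mul_eq_of_quadratic_roots {A B C y w : ℂ} (hyw : y ≠ w) (hy : A * y ^ 2 + B * y + C = 0)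
    (hw : A * w ^ 2 + B * w + C = 0) : A * (y * w) = C := by
  refine mul_left_cancel₀ (sub_ne_zero.2 hyw) ?_
  linear_combination w * hy - y * hw

theorem sum_eq_of_cubic_roots {s b c x y w : ℂ} (hxy : x ≠ y) (hxw : x ≠ w) (hyw : y ≠ w)
    (hx : x ^ 3 - s * x ^ 2 + b * x + c = 0) (hy : y ^ 3 - s * y ^ 2 + b * y + c = 0)
    (hw : w ^ 3 - s * w ^ 2 + b * w + c = 0) : x + y + w = s := by
  have h1 : x ^ 2 + x * y + y ^ 2 - s * (x + y) + b = 0 := by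
    refine mul_left_cancel₀ (sub_ne_zero.2 hxy) ?_
    linear_combination hx - hy
  have h2 : x ^ 2 + x * w + w ^ 2 - s * (x + w) + b = 0 := by
    refine mul_left_cancel₀ (sub_ne_zero.2 hxw) ?_
    linear_combination hx - hw
  refine mul_left_cancel₀ (sub_ne_zero.2 hyw) ?_
  linear_combination h1 - h2

/-- The orthocentre of a triangle inscribed in the unit circle and circumscribing an ellipse with
foci `f`, `g` depends affinely on the product of the vertices. -/
theorem sum_eq_of_chord_tangency {x y w f g κ : ℂ}
    (hxy : x ≠ y) (hxw : x ≠ w) (hyw : y ≠ w)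
    (h₁ : (f + x * y * conj f - x - y) * (g + x * y * conj g - x - y) = κ * (x * y))
    (h₂ : (f + x * w * conj f - x - w) * (g + x * w * conj g - x - w) = κ * (x * w))
    (h₃ : (f + y * w * conj f - y - w) * (g + y * w * conj g - y - w) = κ * (y * w)) :
    x + y + w = f + g + x * y * w * (conj f * conj g) := by
  -- With the vertex `p` fixed, the other two are the roots of the quadratic tangency equation; this
  -- is their product.
  have key : ∀ {p q r : ℂ}, q ≠ r →
      (f + p * q * conj f - p - q) * (g + p * q * conj g - p - q) = κ * (p * q) →
      (f + p * r * conj f - p - r) * (g + p * r * conj g - p - r) = κ * (p * r) →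
      (p * conj f - 1) * (p * conj g - 1) * (q * r) = (f - p) * (g - p) := by
    intro p q r hqr hq hr
    refine mul_eq_of_quadratic_roots (B := (f - p) * (p * conj g - 1) +
      (g - p) * (p * conj f - 1) - κ * p) hqr ?_ ?_
    · linear_combination hq
    · linear_combination hr
  have hx := key hyw h₁ h₂
  have hy := key hxw (by linear_combination h₁) h₃
  have hw := key (p := w) hxy (by linear_combination h₂) (by linear_combination h₃)
  -- With λ = xyw, each relation times its vertex p reads λ(p·f̄ - 1)(p·ḡ - 1) = p(f - p)(g - p),
  -- one cubic satisfied by all three vertices.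
  refine sum_eq_of_cubic_roots (b := f * g + x * y * w * (conj f + conj g))
    (c := -(x * y * w)) hxy hxw hyw ?_ ?_ ?_
  · linear_combination (-x) * hx
  · linear_combination (-y) * hy
  · linear_combination (-w) * hw

end Poncelet

/-! ### Acuteness when the centre lies inside the ellipse -/

section Acute

/-- In the plane, two vectors orthogonal to the same nonzero vector are proportional. -/
theorem exists_smul_eq_of_inner_eq_zero {m v d : ℂ} (hm : m ≠ 0) (hd : d ≠ 0)
    (hv : inner ℝ m v = 0) (hd' : inner ℝ m d = 0) : ∃ r : ℝ, v = r * d := by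
  simp only [Complex.inner, Complex.mul_re, Complex.conj_re, Complex.conj_im] at hv hd'
  have hcross : v.re * d.im - v.im * d.re = 0 := by
    by_contra hne
    apply hm
    apply Complex.ext
    · refine (mul_eq_zero.1 (?_ : m.re * (v.re * d.im - v.im * d.re) = 0)).resolve_right hne
      linear_combination d.im * hv - v.im * hd'
    · refine (mul_eq_zero.1 (?_ : m.im * (v.re * d.im - v.im * d.re) = 0)).resolve_right hne
      linear_combination -d.re * hv + v.re * hd'
  have hdn : d.re ^ 2 + d.im ^ 2 ≠ 0 := by
    intro h
    apply hd
    apply Complex.ext <;> simp <;> nlinarith [sq_nonneg d.re, sq_nonneg d.im]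
  refine ⟨(v.re * d.re + v.im * d.im) / (d.re ^ 2 + d.im ^ 2), ?_⟩
  apply Complex.ext
  · rw [Complex.re_ofReal_mul]; field_simp; linear_combination d.im * hcross
  · rw [Complex.im_ofReal_mul]; field_simp; linear_combination -d.re * hcross

/-- If the angle at `A` were not acute, the line `BC` would separate `O` from `A`, hence from the
point `t` of `AB`. The segment from `O` to `t` would then meet `BC` where, by convexity, the sum of
the focal distances is below `2 * a`. -/
theorem inner_pos_of_center_inside {A B C O f g t : ℂ} {a R s : ℝ}
    (hA : dist A O = R) (hB : dist B O = R) (hC : dist C O = R) (hBC : B ≠ C)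
    (hAline : A ∉ line[ℝ, B, C])
    (hline : ∀ z ∈ line[ℝ, B, C], 2 * a ≤ dist z f + dist z g)
    (hs1 : s < 1) (ht : t = A + s * (B - A)) (htE : dist t f + dist t g ≤ 2 * a)
    (hO : dist O f + dist O g < 2 * a) : 0 < inner ℝ (B - A) (C - A) := by
  set M : ℂ := (B + C) / 2 - O with hM
  have hsq : ∀ {X : ℂ}, dist X O = R → (X.re - O.re) ^ 2 + (X.im - O.im) ^ 2 = R ^ 2 := by
    intro X hX
    rw [← hX, dist_eq_norm, ← Complex.normSq_eq_norm_sq, Complex.normSq_apply]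
    simp; ring
  have hA' := hsq hA
  have hB' := hsq hB
  have hC' := hsq hC
  have hMre : M.re = (B.re + C.re) / 2 - O.re := by simp [hM]
  have hMim : M.im = (B.im + C.im) / 2 - O.im := by simp [hM]
  have hMd : inner ℝ M (C - B) = 0 := by
    simp only [Complex.inner, Complex.mul_re, Complex.conj_re, Complex.conj_im, Complex.sub_re,
      Complex.sub_im, hMre, hMim]
    linear_combination (hC' - hB') / 2
  -- An affine function vanishing on `BC` and negative at `O`; its value at `A` is minus half the
  -- inner product in the goal.
  set l : ℂ → ℝ := fun z ↦ inner ℝ M (z - O - M) with hl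
  have hlmem : M ≠ 0 → ∀ z, l z = 0 → z ∈ line[ℝ, B, C] := by
    intro hM0 z hz
    obtain ⟨r, hr⟩ := exists_smul_eq_of_inner_eq_zero hM0 (sub_ne_zero.2 hBC.symm) hz hMd
    rw [mem_affineSpan_pair_iff_exists_lineMap_eq]
    refine ⟨r + 1 / 2, ?_⟩
    rw [AffineMap.lineMap_apply]
    simp only [vsub_eq_sub, vadd_eq_add, Complex.real_smul]
    push_cast
    linear_combination -hr + hM
  have hM0 : M ≠ 0 := by
    intro h0
    refine hO.not_ge (hline O ?_)
    rw [mem_affineSpan_pair_iff_exists_lineMap_eq]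
    refine ⟨1 / 2, ?_⟩
    rw [AffineMap.lineMap_apply]
    simp only [vsub_eq_sub, vadd_eq_add, Complex.real_smul]
    push_cast
    linear_combination h0 - hM
  have hlO : l O < 0 := by
    simp only [hl, sub_self, zero_sub, inner_neg_right, real_inner_self_eq_norm_sq]
    have : 0 < ‖M‖ := norm_pos_iff.2 hM0
    simp [hM0]
  have hinner : inner ℝ (B - A) (C - A) = -2 * l A := by
    simp only [hl, Complex.inner, Complex.mul_re, Complex.conj_re, Complex.conj_im,
      Complex.sub_re, Complex.sub_im, hMre, hMim]
    linear_combination hA' - (hB' + hC') / 2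
  rw [hinner]
  by_contra! hneg
  have hlA : 0 < l A := lt_of_le_of_ne (by linarith) fun h ↦ hAline (hlmem hM0 A h.symm)
  have hlB : l B = 0 := by
    simp only [hl, show B - O - M = (-(1 / 2) : ℝ) • (C - B) by
      rw [Complex.real_smul]; push_cast; linear_combination -hM, inner_smul_right, hMd, mul_zero]
  have haff : ∀ (X Y : ℂ) (r : ℝ), l (X + r * (Y - X)) = (1 - r) * l X + r * l Y := by
    intro X Y r
    simp only [hl, Complex.inner, Complex.mul_re, Complex.conj_re, Complex.conj_im,
      Complex.sub_re, Complex.sub_im, Complex.add_re, Complex.add_im, Complex.ofReal_re,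
      Complex.ofReal_im, Complex.mul_im]
    ring
  have hlt : 0 < l t := by
    rw [ht, haff, hlB, mul_zero, add_zero]
    exact mul_pos (by linarith) hlA
  -- The parameter at which the segment from `O` to `t` crosses `BC`.
  set r : ℝ := -l O / (l t - l O) with hr
  have hden : 0 < l t - l O := by linarith
  have hr0 : 0 ≤ r := div_nonneg (by linarith) hden.le
  have hr1 : r < 1 := by rw [hr, div_lt_one hden]; linarith
  have hq : l (O + r * (t - O)) = 0 := by
    rw [haff, hr]; field_simp; ring
  have hconv : ∀ w : ℂ, dist (O + r * (t - O)) w ≤ (1 - r) * dist O w + r * dist t w := by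
    intro w
    rw [dist_eq_norm, dist_eq_norm, dist_eq_norm,
      show O + r * (t - O) - w = ((1 - r : ℝ) : ℂ) * (O - w) + (r : ℂ) * (t - w) by
        push_cast; ring]
    refine (norm_add_le _ _).trans_eq ?_
    rw [norm_mul, norm_mul, Complex.norm_real, Complex.norm_real, Real.norm_of_nonneg hr0,
      Real.norm_of_nonneg (by linarith)]
  have h1 := hline _ (hlmem hM0 _ hq)
  have h2 := hconv f
  have h3 := hconv g
  have h4 := mul_lt_mul_of_pos_left hO (by linarith : (0 : ℝ) < 1 - r)
  have h5 := mul_le_mul_of_nonneg_left htE hr0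
  linarith

/-- A point of a line through two points of a circle which lies inside the circle is between
them. -/
theorem param_mem_Ioo_of_dist_lt {A B O : ℂ} {R s : ℝ} (hA : dist A O = R) (hB : dist B O = R)
    (h : dist (A + s * (B - A)) O < R) : 0 < s ∧ s < 1 := by
  have hsq : ∀ X : ℂ, dist X O ^ 2 = (X.re - O.re) ^ 2 + (X.im - O.im) ^ 2 := by
    intro X
    rw [dist_eq_norm, ← Complex.normSq_eq_norm_sq, Complex.normSq_apply]
    simp; ring
  have h1 := hsq A
  have h2 := hsq B
  have h3 := hsq (A + s * (B - A))
  have h4 : dist (A + s * (B - A)) O ^ 2 < R ^ 2 := pow_lt_pow_left₀ h dist_nonneg two_ne_zero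
  rw [hA] at h1
  rw [hB] at h2
  rw [h3] at h4
  simp only [Complex.add_re, Complex.add_im, Complex.re_ofReal_mul, Complex.im_ofReal_mul,
    Complex.sub_re, Complex.sub_im] at h4
  -- The power of the point with respect to the circle, up to sign.
  have h5 : 0 < s * (1 - s) * ((B.re - A.re) ^ 2 + (B.im - A.im) ^ 2) := by
    have : s * (1 - s) * ((B.re - A.re) ^ 2 + (B.im - A.im) ^ 2) =
        R ^ 2 - ((A.re + s * (B.re - A.re) - O.re) ^ 2 +
          (A.im + s * (B.im - A.im) - O.im) ^ 2) := by
      linear_combination (s - 1) * h1 - s * h2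
    rw [this]
    linarith
  have h6 : 0 < s * (1 - s) := pos_of_mul_pos_left h5 (by positivity)
  constructor <;> nlinarith

end Acute
-- Symmetric-function identities for triangles inscribed in the unit circle
section UnitCircle

open ComplexConjugate

theorem inner_complex_eq (u v : ℂ) : ((inner ℝ u v : ℝ) : ℂ) = (u * conj v + conj u * v) / 2 := by
  rw [Complex.inner, Complex.re_eq_add_conj]
  simp
  ring

variable {x y w : ℂ}

theorem ofReal_inner_sub_sub (hx : ‖x‖ = 1) (hy : ‖y‖ = 1) (hw : ‖w‖ = 1) :
    ((inner ℝ (y - x) (w - x) : ℝ) : ℂ) =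
      -((y - x) * (w - x) * (y + w)) / (2 * (x * y * w)) := by
  have := ne_zero_of_norm_eq_one hx
  have := ne_zero_of_norm_eq_one hy
  have := ne_zero_of_norm_eq_one hw
  rw [inner_complex_eq]
  simp only [map_sub, conj_eq_inv_of_norm_eq_one hx, conj_eq_inv_of_norm_eq_one hy,
    conj_eq_inv_of_norm_eq_one hw]
  field_simp
  ring

theorem conj_sum_eq (hx : ‖x‖ = 1) (hy : ‖y‖ = 1) (hw : ‖w‖ = 1) :
    conj (x + y + w) = (x * y + y * w + w * x) / (x * y * w) := by
  have := ne_zero_of_norm_eq_one hx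
  have := ne_zero_of_norm_eq_one hy
  have := ne_zero_of_norm_eq_one hw
  simp only [map_add, conj_eq_inv_of_norm_eq_one hx, conj_eq_inv_of_norm_eq_one hy,
    conj_eq_inv_of_norm_eq_one hw]
  field_simp
  ring

theorem ofReal_norm_sum_sq (hx : ‖x‖ = 1) (hy : ‖y‖ = 1) (hw : ‖w‖ = 1) :
    ((‖x + y + w‖ ^ 2 : ℝ) : ℂ) =
      (x + y + w) * (x * y + y * w + w * x) / (x * y * w) := by
  rw [Complex.ofReal_pow, ← Complex.mul_conj', conj_sum_eq hx hy hw, mul_div_assoc]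

/-- The left side is e₁e₂ - e₃, and |e₁|² = e₁e₂/e₃. -/
theorem prod_add_eq (hx : ‖x‖ = 1) (hy : ‖y‖ = 1) (hw : ‖w‖ = 1) :
    (x + y) * (y + w) * (w + x) = -(x * y * w) * ((1 - ‖x + y + w‖ ^ 2 : ℝ) : ℂ) := by
  have := ne_zero_of_norm_eq_one hx
  have := ne_zero_of_norm_eq_one hy
  have := ne_zero_of_norm_eq_one hw
  rw [Complex.ofReal_sub, Complex.ofReal_one, ofReal_norm_sum_sq hx hy hw]
  field_simp
  ring

/-- The product of the (unnormalised) cosines of a triangle inscribed in the unit circle. -/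
theorem prod_inner_eq (hx : ‖x‖ = 1) (hy : ‖y‖ = 1) (hw : ‖w‖ = 1) :
    8 * (inner ℝ (y - x) (w - x) * inner ℝ (w - y) (x - y) * inner ℝ (x - w) (y - w)) =
      ‖x - y‖ ^ 2 * ‖y - w‖ ^ 2 * ‖w - x‖ ^ 2 * (1 - ‖x + y + w‖ ^ 2) := by
  have := ne_zero_of_norm_eq_one hx
  have := ne_zero_of_norm_eq_one hy
  have := ne_zero_of_norm_eq_one hw
  apply Complex.ofReal_injective
  simp only [Complex.ofReal_mul _ _, Complex.ofReal_sub, Complex.ofReal_one]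
  rw [ofReal_inner_sub_sub hx hy hw, ofReal_inner_sub_sub hy hw hx, ofReal_inner_sub_sub hw hx hy,
    ofReal_norm_sub_sq hx hy, ofReal_norm_sub_sq hy hw, ofReal_norm_sub_sq hw hx,
    ofReal_norm_sum_sq hx hy hw]
  push_cast
  field_simp
  ring

theorem norm_sum_sq_lt_one (hx : ‖x‖ = 1) (hy : ‖y‖ = 1) (hw : ‖w‖ = 1)
    (h₁ : 0 < inner ℝ (y - x) (w - x)) (h₂ : 0 < inner ℝ (w - y) (x - y))
    (h₃ : 0 < inner ℝ (x - w) (y - w)) : ‖x + y + w‖ ^ 2 < 1 := by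
  have h := prod_inner_eq hx hy hw
  have h' : 0 < ‖x - y‖ ^ 2 * ‖y - w‖ ^ 2 * ‖w - x‖ ^ 2 * (1 - ‖x + y + w‖ ^ 2) := by
    rw [← h]; positivity
  linarith [pos_of_mul_pos_right h' (by positivity)]

theorem add_ne_zero_of_inner_pos (hx : ‖x‖ = 1) (hy : ‖y‖ = 1) (hw : ‖w‖ = 1)
    (h : 0 < inner ℝ (y - x) (w - x)) : y + w ≠ 0 := by
  intro h0
  have := ofReal_inner_sub_sub hx hy hw
  rw [h0, mul_zero, neg_zero, zero_div, Complex.ofReal_eq_zero] at this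
  exact h.ne' this

/-! ### Poles of chords and the circles of the tangential triangle -/

/-- The intersection of the tangents to the unit circle at `x` and `y`. -/
noncomputable def chordPole (x y : ℂ) : ℂ :=
  2 * (x * y) / (x + y)

theorem chordPole_comm (x y : ℂ) : chordPole x y = chordPole y x := by
  rw [chordPole, chordPole, mul_comm x, add_comm x]

/-- The tangent at p has the equation p²·v̄ + v = 2p; eliminating v̄ between two tangents gives the
pole. -/
theorem eq_chordPole {v : ℂ} (hx : ‖x‖ = 1) (hy : ‖y‖ = 1) (hxy : x ≠ y) (hxy' : x + y ≠ 0)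
    (h₁ : inner ℝ x v = 1) (h₂ : inner ℝ y v = 1) : v = chordPole x y := by
  have hx0 := ne_zero_of_norm_eq_one hx
  have hy0 := ne_zero_of_norm_eq_one hy
  have key : ∀ {p : ℂ}, ‖p‖ = 1 → inner ℝ p v = 1 → p ^ 2 * conj v + v = 2 * p := by
    intro p hp h
    have hp0 := ne_zero_of_norm_eq_one hp
    have h' := inner_complex_eq p v
    rw [h, conj_eq_inv_of_norm_eq_one hp] at h'
    field_simp at h'
    push_cast at h'
    linear_combination -h'
  rw [chordPole, eq_div_iff hxy']
  refine mul_left_cancel₀ (sub_ne_zero.2 hxy.symm) ?_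
  linear_combination y ^ 2 * key hx h₁ - x ^ 2 * key hy h₂

theorem conj_chordPole (hx : ‖x‖ = 1) (hy : ‖y‖ = 1) (hxy' : x + y ≠ 0) :
    conj (chordPole x y) = 2 / (x + y) := by
  have hx0 := ne_zero_of_norm_eq_one hx
  have hy0 := ne_zero_of_norm_eq_one hy
  have : y + x ≠ 0 := by rwa [add_comm]
  simp only [chordPole, map_div₀, map_mul, map_add, conj_eq_inv_of_norm_eq_one hx,
    conj_eq_inv_of_norm_eq_one hy, map_ofNat]
  field_simp
  ring

theorem inner_chordPole_left (hx : ‖x‖ = 1) (hy : ‖y‖ = 1) (hxy' : x + y ≠ 0) :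
    inner ℝ x (chordPole x y) = 1 := by
  have hx0 := ne_zero_of_norm_eq_one hx
  apply Complex.ofReal_injective
  rw [inner_complex_eq, conj_chordPole hx hy hxy', conj_eq_inv_of_norm_eq_one hx, chordPole]
  push_cast
  field_simp

/-- An acute angle at `x` puts the pole of the opposite side on the same side of the tangent at `x`
as the centre. This is what makes the circle the incircle rather than an excircle. -/
theorem inner_chordPole_lt_one (hx : ‖x‖ = 1) (hy : ‖y‖ = 1) (hw : ‖w‖ = 1)
    (h : 0 < inner ℝ (y - x) (w - x)) : inner ℝ x (chordPole y w) < 1 := by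
  have hx0 := ne_zero_of_norm_eq_one hx
  have hy0 := ne_zero_of_norm_eq_one hy
  have hw0 := ne_zero_of_norm_eq_one hw
  have hyw := add_ne_zero_of_inner_pos hx hy hw h
  have hnorm : ((‖y + w‖ ^ 2 : ℝ) : ℂ) = (y + w) ^ 2 / (y * w) := by
    rw [Complex.ofReal_pow, ← Complex.mul_conj', map_add, conj_eq_inv_of_norm_eq_one hy,
      conj_eq_inv_of_norm_eq_one hw]
    field_simp
    ring
  have key : (1 - inner ℝ x (chordPole y w)) * ‖y + w‖ ^ 2 = 2 * inner ℝ (y - x) (w - x) := by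
    apply Complex.ofReal_injective
    rw [Complex.ofReal_mul, Complex.ofReal_mul, Complex.ofReal_sub, hnorm,
      ofReal_inner_sub_sub hx hy hw, inner_complex_eq, conj_chordPole hy hw hyw,
      conj_eq_inv_of_norm_eq_one hx, chordPole]
    push_cast
    field_simp
    ring
  have : 0 < (1 - inner ℝ x (chordPole y w)) * ‖y + w‖ ^ 2 := by rw [key]; positivity
  linarith [pos_of_mul_pos_left this (by positivity)]

/-- The distance from the vertices of the tangential triangle to its circumcentre. -/
theorem norm_chordPole_sub (hx : ‖x‖ = 1) (hy : ‖y‖ = 1) (hw : ‖w‖ = 1) (hyw : y + w ≠ 0)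
    (h : ‖x + y + w‖ ^ 2 < 1) :
    ‖chordPole y w - -(2 / (1 - ‖x + y + w‖ ^ 2) : ℝ) * (x + y + w)‖ =
      2 / (1 - ‖x + y + w‖ ^ 2) := by
  have hx0 := ne_zero_of_norm_eq_one hx
  have hy0 := ne_zero_of_norm_eq_one hy
  have hw0 := ne_zero_of_norm_eq_one hw
  have hD := prod_add_eq hx hy hw
  set H : ℝ := 1 - ‖x + y + w‖ ^ 2 with hH
  have hHpos : 0 < H := by linarith
  have hHc : (H : ℂ) ≠ 0 := by exact_mod_cast hHpos.ne'
  -- In this form the modulus is visible, since `y * w / x` is unimodular.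
  have key : chordPole y w - -(2 / H : ℝ) * (x + y + w) = -(2 / H : ℝ) * (y * w / x) := by
    rw [chordPole]
    push_cast
    field_simp
    linear_combination hD
  rw [key, norm_mul, norm_neg, Complex.norm_real, Real.norm_of_nonneg (by positivity), norm_div,
    norm_mul, hx, hy, hw]
  simp

/-- The centre of the nine-point circle of the tangential triangle. -/
theorem ninePoint_center_eq (hx : ‖x‖ = 1) (hy : ‖y‖ = 1) (hw : ‖w‖ = 1) (hxy : x + y ≠ 0)
    (hyw : y + w ≠ 0) (hwx : w + x ≠ 0) (h : ‖x + y + w‖ ^ 2 < 1) :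
    (chordPole y w + chordPole w x + chordPole x y -
      -(2 / (1 - ‖x + y + w‖ ^ 2) : ℝ) * (x + y + w)) / 2 =
      -((1 / (1 - ‖x + y + w‖ ^ 2) : ℝ) * ((x * y + y * w + w * x) ^ 2 / (x * y * w))) := by
  have hx0 := ne_zero_of_norm_eq_one hx
  have hy0 := ne_zero_of_norm_eq_one hy
  have hw0 := ne_zero_of_norm_eq_one hw
  have hD := prod_add_eq hx hy hw
  set H : ℝ := 1 - ‖x + y + w‖ ^ 2 with hH
  have hHpos : 0 < H := by linarith
  have hHc : (H : ℂ) = -((x + y) * (y + w) * (w + x)) / (x * y * w) := by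
    field_simp
    linear_combination hD
  simp only [chordPole, Complex.ofReal_div, hHc]
  push_cast
  field_simp
  ring

/-! ### The point K = e₂/e₁ and the centre X₁₁₀ -/

variable {K : ℂ}

/-- Because e₂ = e₃·conj e₁, the numbers e₁ and e₂ have equal modulus. -/
theorem norm_eq_one_of_mul_eq (hx : ‖x‖ = 1) (hy : ‖y‖ = 1) (hw : ‖w‖ = 1)
    (h0 : x + y + w ≠ 0) (hK : K * (x + y + w) = x * y + y * w + w * x) : ‖K‖ = 1 := by
  have hx0 := ne_zero_of_norm_eq_one hx
  have hy0 := ne_zero_of_norm_eq_one hy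
  have hw0 := ne_zero_of_norm_eq_one hw
  have h1 : K * (x + y + w) = x * y * w * conj (x + y + w) := by
    rw [hK, conj_sum_eq hx hy hw]
    field_simp
  have h2 := congrArg norm h1
  rw [norm_mul, norm_mul, norm_mul, norm_mul, hx, hy, hw, Complex.norm_conj, one_mul, one_mul]
    at h2
  exact mul_right_cancel₀ (norm_ne_zero_iff.2 h0) h2

theorem ninePoint_center_eq_mul (hx : ‖x‖ = 1) (hy : ‖y‖ = 1) (hw : ‖w‖ = 1)
    (hK : K * (x + y + w) = x * y + y * w + w * x) :
    (x * y + y * w + w * x) ^ 2 / (x * y * w) = (‖x + y + w‖ ^ 2 : ℝ) * K := by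
  rw [ofReal_norm_sum_sq hx hy hw, ← hK]
  ring

/-- The sum of the unnormalised barycentric coordinates of `X₁₁₀`. -/
theorem x110_weights_sum (hx : ‖x‖ = 1) (hy : ‖y‖ = 1) (hw : ‖w‖ = 1) {a b c : ℝ}
    (ha : a = ‖y - w‖) (hb : b = ‖w - x‖) (hc : c = ‖x - y‖) :
    a ^ 2 * (c ^ 2 - a ^ 2) * (a ^ 2 - b ^ 2) + b ^ 2 * (a ^ 2 - b ^ 2) * (b ^ 2 - c ^ 2) +
      c ^ 2 * (b ^ 2 - c ^ 2) * (c ^ 2 - a ^ 2) =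
      -(a ^ 2 * b ^ 2 * c ^ 2 * ‖x + y + w‖ ^ 2) := by
  have hx0 := ne_zero_of_norm_eq_one hx
  have hy0 := ne_zero_of_norm_eq_one hy
  have hw0 := ne_zero_of_norm_eq_one hw
  subst ha hb hc
  apply Complex.ofReal_injective
  simp only [Complex.ofReal_mul _ _, Complex.ofReal_sub, Complex.ofReal_add, Complex.ofReal_neg]
  rw [ofReal_norm_sub_sq hx hy, ofReal_norm_sub_sq hy hw, ofReal_norm_sub_sq hw hx,
    ofReal_norm_sum_sq hx hy hw]
  field_simp
  ring

/-- Together with `x110_weights_sum` this says e₁·X₁₁₀ = e₂ when e₁ ≠ 0. -/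
theorem x110_weighted_sum (hx : ‖x‖ = 1) (hy : ‖y‖ = 1) (hw : ‖w‖ = 1) {a b c : ℝ}
    (ha : a = ‖y - w‖) (hb : b = ‖w - x‖) (hc : c = ‖x - y‖) :
    (x + y + w) * (((a ^ 2 * (c ^ 2 - a ^ 2) * (a ^ 2 - b ^ 2) : ℝ) : ℂ) * x +
      ((b ^ 2 * (a ^ 2 - b ^ 2) * (b ^ 2 - c ^ 2) : ℝ) : ℂ) * y +
      ((c ^ 2 * (b ^ 2 - c ^ 2) * (c ^ 2 - a ^ 2) : ℝ) : ℂ) * w) =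
    -((x * y + y * w + w * x) * ((a ^ 2 * b ^ 2 * c ^ 2 * ‖x + y + w‖ ^ 2 : ℝ) : ℂ)) := by
  have hx0 := ne_zero_of_norm_eq_one hx
  have hy0 := ne_zero_of_norm_eq_one hy
  have hw0 := ne_zero_of_norm_eq_one hw
  subst ha hb hc
  simp only [Complex.ofReal_mul _ _, Complex.ofReal_sub]
  rw [ofReal_norm_sub_sq hx hy, ofReal_norm_sub_sq hy hw, ofReal_norm_sub_sq hw hx,
    ofReal_norm_sum_sq hx hy hw]
  field_simp
  ring

/-- A triangle inscribed in the unit circle is equilateral when its orthocentre is the origin. -/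
theorem sum_eq_zero_of_norm_sub_eq (hx : ‖x‖ = 1) (hy : ‖y‖ = 1) (hw : ‖w‖ = 1)
    (hxy : x ≠ y) (hxw : x ≠ w) (hyw : y ≠ w) (h₁ : ‖x - y‖ = ‖y - w‖)
    (h₂ : ‖y - w‖ = ‖w - x‖) : x + y + w = 0 := by
  have key : ∀ {p q r : ℂ}, ‖p‖ = 1 → ‖q‖ = 1 → ‖r‖ = 1 → p ≠ r → ‖p - q‖ = ‖q - r‖ →
      p * r = q ^ 2 := by
    intro p q r hp hq hr hpr h
    have hp0 := ne_zero_of_norm_eq_one hp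
    have hq0 := ne_zero_of_norm_eq_one hq
    have hr0 := ne_zero_of_norm_eq_one hr
    have e : ((‖p - q‖ ^ 2 : ℝ) : ℂ) = ((‖q - r‖ ^ 2 : ℝ) : ℂ) := by rw [h]
    rw [ofReal_norm_sub_sq hp hq, ofReal_norm_sub_sq hq hr] at e
    field_simp at e
    refine mul_left_cancel₀ (sub_ne_zero.2 hpr) ?_
    linear_combination -e
  have e1 := key hx hy hw hxw h₁
  have e2 := key hy hw hx hxy.symm h₂
  refine mul_left_cancel₀ (sub_ne_zero.2 hyw) ?_
  linear_combination e2 - e1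

/-- Conjugating e₁ = 0 gives e₂ = 0, and the tangential triangle is then the image of the triangle
under the homothety of ratio -2 about the origin. -/
theorem norm_chordPole_sub_of_sum_eq_zero (hx : ‖x‖ = 1) (hy : ‖y‖ = 1) (hw : ‖w‖ = 1)
    (h : x + y + w = 0) : ‖chordPole y w - chordPole w x‖ = 2 * ‖x - y‖ ∧ ‖x - y‖ ^ 2 = 3 := by
  have hx0 := ne_zero_of_norm_eq_one hx
  have hy0 := ne_zero_of_norm_eq_one hy
  have hw0 := ne_zero_of_norm_eq_one hw
  have hc := conj_sum_eq hx hy hw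
  rw [h, map_zero, eq_comm, div_eq_zero_iff] at hc
  have he2 : x * y + y * w + w * x = 0 := hc.resolve_right (by positivity)
  constructor
  · have : chordPole y w - chordPole w x = -2 * (x - y) := by
      rw [chordPole, chordPole, show y + w = -x by linear_combination h,
        show w + x = -y by linear_combination h]
      field_simp
      linear_combination (x - y) * he2
    rw [this, norm_mul]
    simp
  · apply Complex.ofReal_injective
    rw [ofReal_norm_sub_sq hx hy]
    push_cast
    field_simp
    linear_combination -(x + y) * h + he2

end UnitCircle
-- Acuteness, circumcircle and incircle of a triangle
section Triangle

theorem eq_add_one_or_eq_add_two_of_ne {i j : Fin 3} (h : i ≠ j) : j = i + 1 ∨ j = i + 2 := by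
  decide +revert

theorem add_one_ne_add_two (i : Fin 3) : i + 1 ≠ i + 2 := by
  decide +revert

theorem add_two_add_one (i : Fin 3) : i + 2 + 1 = i := by
  decide +revert

theorem add_two_add_two (i : Fin 3) : i + 2 + 2 = i + 1 := by
  decide +revert

theorem angle_lt_pi_div_two_iff {p q r : ℂ} (hp : p ≠ q) (hr : r ≠ q) :
    ∠ p q r < Real.pi / 2 ↔ 0 < inner ℝ (p - q) (r - q) := by
  have h : 0 < ‖p - q‖ * ‖r - q‖ :=
    mul_pos (norm_pos_iff.2 (sub_ne_zero.2 hp)) (norm_pos_iff.2 (sub_ne_zero.2 hr))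
  rw [EuclideanGeometry.angle, InnerProductGeometry.angle, Real.arccos_lt_pi_div_two]
  simp only [vsub_eq_sub]
  exact div_pos_iff_of_pos_right h

theorem acuteAngled_iff_inner_pos (T : Affine.Triangle ℝ ℂ) :
    T.AcuteAngled ↔ ∀ i, 0 < inner ℝ (T.points (i + 1) - T.points i)
      (T.points (i + 2) - T.points i) := by
  have hne : ∀ {i j : Fin 3}, i ≠ j → T.points i ≠ T.points j := fun h ↦
    T.independent.injective.ne h
  constructor
  · intro h i
    rw [← angle_lt_pi_div_two_iff (hne (by decide +revert)) (hne (by decide +revert))]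
    exact h _ _ _ (by decide +revert) (by decide +revert) (by decide +revert)
  · intro h i j k hij hik hjk
    rw [angle_lt_pi_div_two_iff (hne hij) (hne hjk.symm)]
    have : (i = j + 1 ∧ k = j + 2) ∨ (i = j + 2 ∧ k = j + 1) := by decide +revert
    rcases this with ⟨rfl, rfl⟩ | ⟨rfl, rfl⟩
    · exact h j
    · rw [real_inner_comm]
      exact h j

theorem affineSpan_range_eq_top (T : Affine.Triangle ℝ ℂ) :
    affineSpan ℝ (Set.range T.points) = ⊤ := by
  rw [T.independent.affineSpan_eq_top_iff_card_eq_finrank_add_one]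
  simp

theorem circumsphere_eq_of_mem {S : Sphere ℂ} {T : Affine.Triangle ℝ ℂ}
    (h : ∀ i, T.points i ∈ S) : T.circumsphere = S := by
  refine (T.circumsphere_unique_dist_eq.2 S ⟨?_, ?_⟩).symm
  · rw [affineSpan_range_eq_top]
    exact AffineSubspace.mem_top _ _ _
  · rintro _ ⟨i, rfl⟩
    exact h i

theorem sideline_isTangentAt_mem {S : Sphere ℂ} {T : Affine.Triangle ℝ ℂ} {i : Fin 3} {p : ℂ}
    (h : S.IsTangentAt p (sideline T i)) {j : Fin 3} (hij : i ≠ j) :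
    inner ℝ (p - S.center) (T.points j - p) = 0 := by
  refine h.inner_right_eq_zero_of_mem ?_
  rw [sideline_eq]
  rcases eq_add_one_or_eq_add_two_of_ne hij with rfl | rfl
  · exact left_mem_affineSpan_pair _ _ _
  · exact right_mem_affineSpan_pair _ _ _

/-- In an inscribed triangle circumscribing an ellipse which contains the centre of the circle,
all angles are acute. -/
theorem acuteAngled_of_center_inside {S : Sphere ℂ} {f g : ℂ} {a : ℝ}
    (hnested : ∀ z ∈ ellipse f g a, dist z S.center < S.radius)
    (hc : dist S.center f + dist S.center g < 2 * a) {T : Affine.Triangle ℝ ℂ}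
    (hT : T ∈ ponceletFamily S (ellipse f g a)) : T.AcuteAngled := by
  obtain ⟨hTS, hTE⟩ := hT
  have hne : ∀ {i j : Fin 3}, i ≠ j → T.points i ≠ T.points j := fun h ↦
    T.independent.injective.ne h
  rw [acuteAngled_iff_inner_pos]
  intro i
  have h₁ := hTE i
  -- The contact point on the side joining vertices `i` and `i + 1` serves as the point `t` on the
  -- side of vertex `i`.
  have h₂ := hTE (i + 2)
  rw [sideline_eq] at h₁ h₂
  rw [add_two_add_one, add_two_add_two] at h₂
  have hBC : T.points (i + 1) ≠ T.points (i + 2) := hne (add_one_ne_add_two i)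
  obtain ⟨t, ⟨ht, htE⟩, -⟩ := h₂
  obtain ⟨s, hs⟩ := mem_affineSpan_pair_iff_exists_lineMap_eq.1 ht
  have hs' : t = T.points i + s * (T.points (i + 1) - T.points i) := by
    rw [← hs, AffineMap.lineMap_apply]
    simp only [vsub_eq_sub, vadd_eq_add, Complex.real_smul]
    ring
  have hlt := hnested t htE
  rw [hs'] at hlt
  refine inner_pos_of_center_inside (hTS i) (hTS (i + 1)) (hTS (i + 2)) hBC ?_
    (fun z hz ↦ h₁.two_mul_le_dist_add_dist hBC hz)
    (param_mem_Ioo_of_dist_lt (hTS i) (hTS (i + 1)) hlt).2 hs' (le_of_eq htE) hc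
  rw [← sideline_eq, sideline, Affine.Simplex.range_faceOpposite_points]
  simp

/-- A circle tangent to the sidelines of a triangle whose centre is inside the triangle is the
incircle. -/
theorem insphere_eq_of_isTangent {S : Sphere ℂ} {T : Affine.Triangle ℝ ℂ}
    (ht : ∀ i, S.IsTangent (sideline T i)) {w : Fin 3 → ℝ} (hw : ∑ i, w i = 1)
    (hpos : ∀ i, 0 < w i)
    (hc : Finset.univ.affineCombination ℝ T.points w = S.center) : T.insphere = S := by
  have hmem : S.center ∈ affineSpan ℝ (Set.range T.points) := by
    rw [affineSpan_range_eq_top]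
    exact AffineSubspace.mem_top _ _ _
  -- Tangency gives the distances only up to sign; positive weights fix the signs, and equal signed
  -- distances characterise the incentre.
  have hdist : ∀ i, T.signedInfDist i S.center = S.radius := by
    intro i
    have h0 : 0 ≤ T.signedInfDist i S.center := by
      rw [← hc, T.signedInfDist_affineCombination i hw]
      exact mul_nonneg (hpos i).le (norm_nonneg _)
    rw [← abs_of_nonneg h0, T.abs_signedInfDist_eq_dist_of_mem_affineSpan_range i hmem]
    exact Sphere.dist_orthogonalProjection_eq_radius_iff_isTangent.2 (ht i)
  have hcen := (T.exists_forall_signedInfDist_eq_iff_eq_incenter hmem).1 ⟨_, hdist⟩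
  refine Sphere.ext hcen.symm ?_
  rw [Affine.Simplex.insphere_radius, ← T.signedInfDist_incenter 0, ← hcen, hdist 0]

end Triangle

/-! ### Vertices of the tangential triangle -/

section Tangential

/-- The vertices of the tangential triangle of the triangle with vertices `z` inscribed in the
unit circle. -/
noncomputable def tangentialVertex (z : Fin 3 → ℂ) (i : Fin 3) : ℂ :=
  chordPole (z (i + 1)) (z (i + 2))

variable {z : Fin 3 → ℂ}

theorem add_ne_zero_of_acute (hz : ∀ i, ‖z i‖ = 1)
    (hacute : ∀ i, 0 < inner ℝ (z (i + 1) - z i) (z (i + 2) - z i)) (i : Fin 3) :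
    z (i + 1) + z (i + 2) ≠ 0 :=
  add_ne_zero_of_inner_pos (hz _) (hz _) (hz _) (hacute i)

theorem inner_tangentialVertex (hz : ∀ i, ‖z i‖ = 1)
    (hacute : ∀ i, 0 < inner ℝ (z (i + 1) - z i) (z (i + 2) - z i)) {i j : Fin 3} (hij : i ≠ j) :
    inner ℝ (z i) (tangentialVertex z j) = 1 := by
  have h := add_ne_zero_of_acute hz hacute j
  rw [tangentialVertex]
  rcases eq_add_one_or_eq_add_two_of_ne hij.symm with rfl | rfl
  · exact inner_chordPole_left (hz _) (hz _) h
  · rw [chordPole_comm]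
    exact inner_chordPole_left (hz _) (hz _) (by rwa [add_comm])

theorem inner_tangentialVertex_self_lt (hz : ∀ i, ‖z i‖ = 1)
    (hacute : ∀ i, 0 < inner ℝ (z (i + 1) - z i) (z (i + 2) - z i)) (i : Fin 3) :
    inner ℝ (z i) (tangentialVertex z i) < 1 :=
  inner_chordPole_lt_one (hz _) (hz _) (hz _) (hacute i)

/-- Pairing with `z j` isolates the weight `w j`, as all other vertices lie on the tangent at `z j`.
For a vanishing combination, total weight 0 yields affine independence and total weight 1 yields
positivity of the weights. -/
theorem inner_sum_tangentialVertex (hz : ∀ i, ‖z i‖ = 1)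
    (hacute : ∀ i, 0 < inner ℝ (z (i + 1) - z i) (z (i + 2) - z i)) (w : Fin 3 → ℝ) (j : Fin 3) :
    inner ℝ (z j) (∑ i, w i • tangentialVertex z i) =
      ∑ i, w i - w j * (1 - inner ℝ (z j) (tangentialVertex z j)) := by
  rw [inner_sum, eq_sub_iff_add_eq, ← eq_sub_iff_add_eq', ← Finset.sum_sub_distrib,
    Finset.sum_eq_single j]
  · rw [inner_smul_right]; ring
  · intro i _ hij
    rw [inner_smul_right, inner_tangentialVertex hz hacute hij.symm, mul_one, sub_self]
  · simp

end Tangential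
-- Transfer from the unit circle to an arbitrary circle
section Normalisation

/-- The complex coordinate in which the circle `S` is the unit circle. -/
noncomputable def unitCoord (S : Sphere ℂ) (p : ℂ) : ℂ :=
  (p - S.center) / S.radius

variable {S : Sphere ℂ} {T T' : Affine.Triangle ℝ ℂ}

theorem sub_center_eq (hS : 0 < S.radius) (p : ℂ) :
    p - S.center = S.radius * unitCoord S p := by
  have : (S.radius : ℂ) ≠ 0 := by exact_mod_cast hS.ne'
  rw [unitCoord]
  field_simp

theorem sub_eq_mul_unitCoord_sub (hS : 0 < S.radius) (p q : ℂ) :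
    p - q = S.radius * (unitCoord S p - unitCoord S q) := by
  linear_combination sub_center_eq hS p - sub_center_eq hS q

theorem norm_unitCoord (hS : 0 < S.radius) {p : ℂ} (hp : p ∈ S) : ‖unitCoord S p‖ = 1 := by
  rw [unitCoord, norm_div, ← dist_eq_norm, mem_sphere.1 hp, Complex.norm_real,
    Real.norm_of_nonneg hS.le, div_self hS.ne']

theorem unitCoord_injective (hS : 0 < S.radius) : Function.Injective (unitCoord S) := by
  intro p q h
  have := sub_eq_mul_unitCoord_sub hS p q
  rwa [h, sub_self, mul_zero, sub_eq_zero] at this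

theorem dist_eq_mul_norm_unitCoord_sub (hS : 0 < S.radius) (p q : ℂ) :
    dist p q = S.radius * ‖unitCoord S p - unitCoord S q‖ := by
  rw [dist_eq_norm, sub_eq_mul_unitCoord_sub hS, norm_mul, Complex.norm_real,
    Real.norm_of_nonneg hS.le]

theorem inner_sub_sub_eq (hS : 0 < S.radius) (p q r s : ℂ) :
    inner ℝ (p - q) (r - s) = S.radius ^ 2 *
      inner ℝ (unitCoord S p - unitCoord S q) (unitCoord S r - unitCoord S s) := by
  rw [sub_eq_mul_unitCoord_sub hS p q, sub_eq_mul_unitCoord_sub hS r s, ← Complex.real_smul,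
    ← Complex.real_smul, real_inner_smul_left, real_inner_smul_right]
  ring

theorem inner_unitCoord_pos (hS : 0 < S.radius) (h : T.AcuteAngled) (i : Fin 3) :
    0 < inner ℝ (unitCoord S (T.points (i + 1)) - unitCoord S (T.points i))
      (unitCoord S (T.points (i + 2)) - unitCoord S (T.points i)) := by
  have := (acuteAngled_iff_inner_pos T).1 h i
  rw [inner_sub_sub_eq hS] at this
  exact pos_of_mul_pos_right this (by positivity)

theorem unitCoord_center_add (hS : 0 < S.radius) (v : ℂ) :
    unitCoord S (S.center + S.radius * v) = v := by
  have : (S.radius : ℂ) ≠ 0 := by exact_mod_cast hS.ne'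
  rw [unitCoord]
  field_simp
  ring

theorem unitCoord_center : unitCoord S S.center = 0 := by
  simp [unitCoord]

theorem inner_center_tangent_eq (hS : 0 < S.radius) {p : ℂ} (hp : p ∈ S) (q : ℂ) :
    inner ℝ (p - S.center) (q - p) =
      S.radius ^ 2 * (inner ℝ (unitCoord S p) (unitCoord S q) - 1) := by
  rw [inner_sub_sub_eq hS, unitCoord_center, sub_zero, inner_sub_right,
    real_inner_self_eq_norm_sq, norm_unitCoord hS hp, one_pow]

/-- An acute inscribed triangle has a tangential triangle. -/
theorem exists_isTangentialTriangle (hS : 0 < S.radius) (hT : ∀ i, T.points i ∈ S)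
    (hacute : T.AcuteAngled) : ∃ T', IsTangentialTriangle T T' := by
  set z : Fin 3 → ℂ := fun i ↦ unitCoord S (T.points i) with hz
  have hz1 : ∀ i, ‖z i‖ = 1 := fun i ↦ norm_unitCoord hS (hT i)
  have hza : ∀ i, 0 < inner ℝ (z (i + 1) - z i) (z (i + 2) - z i) := inner_unitCoord_pos hS hacute
  have hR : (S.radius : ℂ) ≠ 0 := by exact_mod_cast hS.ne'
  set V : Fin 3 → ℂ := fun i ↦ S.center + S.radius * tangentialVertex z i with hV
  have hind : AffineIndependent ℝ V := by
    rw [affineIndependent_iff_of_fintype]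
    intro w hw hsum j
    rw [Finset.weightedVSub_eq_linear_combination _ hw] at hsum
    have h0 : ∑ i, w i • tangentialVertex z i = 0 := by
      have h1 : ∑ i, w i • V i = (∑ i, w i : ℝ) • S.center +
          S.radius * ∑ i, w i • tangentialVertex z i := by
        rw [Finset.sum_smul, Finset.mul_sum, ← Finset.sum_add_distrib]
        refine Finset.sum_congr rfl fun i _ ↦ ?_
        simp only [hV, Complex.real_smul]
        ring
      rw [hsum, hw, zero_smul, zero_add] at h1
      exact (mul_eq_zero.1 h1.symm).resolve_left hR
    have h2 := inner_sum_tangentialVertex hz1 hza w j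
    rw [h0, inner_zero_right, hw, zero_sub, eq_comm, neg_eq_zero] at h2
    refine (mul_eq_zero.1 h2).resolve_right ?_
    linarith [inner_tangentialVertex_self_lt hz1 hza j]
  refine ⟨⟨V, hind⟩, fun i ↦ ?_⟩
  rw [circumsphere_eq_of_mem hT, sideline_eq]
  have hmem : ∀ j, i ≠ j → V j ∈ S.orthRadius (T.points i) := by
    intro j hij
    rw [Sphere.mem_orthRadius_iff_inner_right, vsub_eq_sub, vsub_eq_sub,
      inner_center_tangent_eq hS (hT i), hV, unitCoord_center_add hS,
      inner_tangentialVertex hz1 hza hij, sub_self, mul_zero]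
  have hle : line[ℝ, V (i + 1), V (i + 2)] ≤ S.orthRadius (T.points i) :=
    affineSpan_pair_le_of_mem_of_mem (hmem _ (by clear * -; decide +revert))
      (hmem _ (by clear * -; decide +revert))
  have hne : V (i + 1) ≠ V (i + 2) := hind.injective.ne (add_one_ne_add_two i)
  have hpc : T.points i ≠ S.center := by
    intro h
    have := mem_sphere.1 (hT i)
    rw [h, dist_self] at this
    exact hS.ne this
  -- The side lies in the tangent, and both are one-dimensional.
  have heq : line[ℝ, V (i + 1), V (i + 2)] = S.orthRadius (T.points i) := by
    refine AffineSubspace.eq_of_direction_eq_of_nonempty_of_le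
      (Submodule.eq_of_le_of_finrank_eq (AffineSubspace.direction_le hle) ?_)
      ⟨_, left_mem_affineSpan_pair _ _ _⟩ hle
    have h1 := Sphere.finrank_orthRadius hpc
    rw [Complex.finrank_real_complex] at h1
    rw [direction_affineSpan, vectorSpan_pair, finrank_span_singleton (vsub_ne_zero.2 hne)]
    omega
  change S.IsTangentAt (T.points i) line[ℝ, V (i + 1), V (i + 2)]
  rw [heq]
  exact Sphere.isTangentAt_orthRadius_iff_mem.2 (hT i)

/-- The vertices of a tangential triangle. -/
theorem IsTangentialTriangle.points_eq (hS : 0 < S.radius) (hT : ∀ i, T.points i ∈ S)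
    (hacute : T.AcuteAngled) (h : IsTangentialTriangle T T') (i : Fin 3) :
    unitCoord S (T'.points i) = tangentialVertex (fun j ↦ unitCoord S (T.points j)) i := by
  have key : ∀ j, j ≠ i → inner ℝ (unitCoord S (T.points j)) (unitCoord S (T'.points i)) = 1 := by
    intro j hj
    have h1 := h j
    rw [circumsphere_eq_of_mem hT] at h1
    have h2 := sideline_isTangentAt_mem h1 hj
    rw [inner_center_tangent_eq hS (hT j)] at h2
    have := (mul_eq_zero.1 h2).resolve_left (by positivity)
    linarith
  exact eq_chordPole (norm_unitCoord hS (hT _)) (norm_unitCoord hS (hT _))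
    ((unitCoord_injective hS).ne (T.independent.injective.ne (add_one_ne_add_two i)))
    (add_ne_zero_of_acute (fun j ↦ norm_unitCoord hS (hT j)) (inner_unitCoord_pos hS hacute) i)
    (key _ (by clear * -; decide +revert)) (key _ (by clear * -; decide +revert))

/-- The circumcircle of an acute triangle is the incircle of its tangential triangle. -/
theorem IsTangentialTriangle.insphere_eq (hS : 0 < S.radius) (hT : ∀ i, T.points i ∈ S)
    (hacute : T.AcuteAngled) (h : IsTangentialTriangle T T') : T'.insphere = S := by
  have hp := h.points_eq hS hT hacute
  set z : Fin 3 → ℂ := fun i ↦ unitCoord S (T.points i) with hz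
  have hz1 : ∀ i, ‖z i‖ = 1 := fun i ↦ norm_unitCoord hS (hT i)
  have hza : ∀ i, 0 < inner ℝ (z (i + 1) - z i) (z (i + 2) - z i) := inner_unitCoord_pos hS hacute
  have hR : (S.radius : ℂ) ≠ 0 := by exact_mod_cast hS.ne'
  have hmem : S.center ∈ affineSpan ℝ (Set.range T'.points) := by
    rw [affineSpan_range_eq_top]
    exact AffineSubspace.mem_top _ _ _
  obtain ⟨w, hw, hc⟩ := eq_affineCombination_of_mem_affineSpan_of_fintype hmem
  refine insphere_eq_of_isTangent (fun i ↦ ?_) hw (fun j ↦ ?_) hc.symm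
  · have := h i
    rw [circumsphere_eq_of_mem hT] at this
    exact this.isTangent
  · rw [Finset.affineCombination_eq_linear_combination _ _ _ hw] at hc
    have h0 : ∑ i, w i • tangentialVertex z i = 0 := by
      have h1 : ∑ i, w i • T'.points i = (∑ i, w i : ℝ) • S.center +
          S.radius * ∑ i, w i • tangentialVertex z i := by
        rw [Finset.sum_smul, Finset.mul_sum, ← Finset.sum_add_distrib]
        refine Finset.sum_congr rfl fun i _ ↦ ?_
        rw [← hp i, Complex.real_smul, Complex.real_smul, Complex.real_smul]
        linear_combination (w i : ℂ) * sub_center_eq hS (T'.points i)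
      rw [← hc, hw, one_smul, left_eq_add] at h1
      exact (mul_eq_zero.1 h1).resolve_left hR
    have h2 := inner_sum_tangentialVertex hz1 hza w j
    rw [h0, inner_zero_right, hw, eq_comm, sub_eq_zero] at h2
    refine pos_of_mul_pos_left (h2 ▸ one_pos) ?_
    linarith [inner_tangentialVertex_self_lt hz1 hza j]

theorem norm_sum_unitCoord_sq_lt_one (hS : 0 < S.radius) (hT : ∀ i, T.points i ∈ S)
    (hacute : T.AcuteAngled) :
    ‖unitCoord S (T.points 0) + unitCoord S (T.points 1) + unitCoord S (T.points 2)‖ ^ 2 < 1 :=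
  norm_sum_sq_lt_one (norm_unitCoord hS (hT 0)) (norm_unitCoord hS (hT 1))
    (norm_unitCoord hS (hT 2)) (inner_unitCoord_pos hS hacute 0) (inner_unitCoord_pos hS hacute 1)
    (inner_unitCoord_pos hS hacute 2)

/-- The nine-point circle of the tangential triangle, in terms of the point which turns out to be
its Feuerbach point. -/
theorem IsTangentialTriangle.ninePointCircle_eq (hS : 0 < S.radius) (hT : ∀ i, T.points i ∈ S)
    (hacute : T.AcuteAngled) (h : IsTangentialTriangle T T') {x y w K : ℂ}
    (hx : unitCoord S (T.points 0) = x) (hy : unitCoord S (T.points 1) = y)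
    (hw : unitCoord S (T.points 2) = w) (hK : K * (x + y + w) = x * y + y * w + w * x) :
    T'.ninePointCircle = ⟨S.center - S.radius * ((‖x + y + w‖ ^ 2 / (1 - ‖x + y + w‖ ^ 2) : ℝ) * K),
      S.radius / (1 - ‖x + y + w‖ ^ 2)⟩ := by
  have hp := h.points_eq hS hT hacute
  have hx1 : ‖x‖ = 1 := hx ▸ norm_unitCoord hS (hT 0)
  have hy1 : ‖y‖ = 1 := hy ▸ norm_unitCoord hS (hT 1)
  have hw1 : ‖w‖ = 1 := hw ▸ norm_unitCoord hS (hT 2)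
  have hlt := norm_sum_unitCoord_sq_lt_one hS hT hacute
  have hadd := add_ne_zero_of_acute (fun j ↦ norm_unitCoord hS (hT j))
    (inner_unitCoord_pos hS hacute)
  have hyw : y + w ≠ 0 := by rw [← hy, ← hw]; exact hadd 0
  have hwx : w + x ≠ 0 := by rw [← hw, ← hx]; exact hadd 1
  have hxy : x + y ≠ 0 := by rw [← hx, ← hy]; exact hadd 2
  have h0 : unitCoord S (T'.points 0) = chordPole y w := by rw [hp, ← hy, ← hw]; rfl
  have h1 : unitCoord S (T'.points 1) = chordPole w x := by rw [hp, ← hw, ← hx]; rfl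
  have h2 : unitCoord S (T'.points 2) = chordPole x y := by rw [hp, ← hx, ← hy]; rfl
  rw [hx, hy, hw] at hlt
  -- The circumcentre of the tangential triangle in the unit coordinate, recognised below by its
  -- equal distances from the vertices.
  set c : ℂ := -(2 / (1 - ‖x + y + w‖ ^ 2) : ℝ) * (x + y + w) with hc
  have hmem : S.center + S.radius * c ∈ affineSpan ℝ (Set.range T'.points) := by
    rw [affineSpan_range_eq_top]
    exact AffineSubspace.mem_top _ _ _
  have hdist : ∀ i, dist (T'.points i) (S.center + S.radius * c) =
      S.radius * (2 / (1 - ‖x + y + w‖ ^ 2)) := by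
    intro i
    rw [dist_eq_mul_norm_unitCoord_sub hS, unitCoord_center_add hS]
    congr 1
    fin_cases i
    · exact h0 ▸ norm_chordPole_sub hx1 hy1 hw1 hyw hlt
    · have := norm_chordPole_sub hy1 hw1 hx1 hwx (by rwa [← add_rotate])
      rw [← add_rotate] at this
      exact h1 ▸ this
    · have := norm_chordPole_sub hw1 hx1 hy1 hxy (by rwa [add_rotate])
      rw [add_rotate] at this
      exact h2 ▸ this
  have hcc := T'.eq_circumcenter_of_dist_eq hmem hdist
  have hcr := T'.eq_circumradius_of_dist_eq hmem hdist
  have hn := ninePoint_center_eq hx1 hy1 hw1 hxy hyw hwx hlt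
  rw [ninePoint_center_eq_mul hx1 hy1 hw1 hK, ← hc] at hn
  apply Sphere.ext
  · rw [Affine.Simplex.ninePointCircle_center, ← hcc, Affine.Simplex.centroid,
      Finset.centroid_def, Finset.affineCombination_eq_linear_combination _ _ _
        (Finset.sum_centroidWeights_eq_one_of_card_ne_zero _ _ (by simp))]
    simp only [Finset.centroidWeights_apply, Complex.real_smul, vsub_eq_sub,
      vadd_eq_add, Finset.card_univ, Fintype.card_fin]
    have e0 := sub_center_eq hS (T'.points 0)
    have e1 := sub_center_eq hS (T'.points 1)
    have e2 := sub_center_eq hS (T'.points 2)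
    rw [h0] at e0
    rw [h1] at e1
    rw [h2] at e2
    have hsum := Fin.sum_univ_three fun i ↦ (3⁻¹ : ℂ) * T'.points i
    push_cast at hn ⊢
    -- The factor 3/2 takes the circumcentre-to-centroid vector to the
    -- circumcentre-to-nine-point-centre vector.
    linear_combination (e0 + e1 + e2) / 2 + S.radius * hn + 3 / 2 * hsum
  · rw [Affine.Simplex.ninePointCircle_radius, ← hcr]
    push_cast
    ring

theorem IsTangentialTriangle.isFeuerbachPoint (hS : 0 < S.radius) (hT : ∀ i, T.points i ∈ S)
    (hacute : T.AcuteAngled) (h : IsTangentialTriangle T T') {x y w K : ℂ}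
    (hx : unitCoord S (T.points 0) = x) (hy : unitCoord S (T.points 1) = y)
    (hw : unitCoord S (T.points 2) = w) (h0 : x + y + w ≠ 0)
    (hK : K * (x + y + w) = x * y + y * w + w * x) :
    IsFeuerbachPoint T' (S.center + S.radius * K) := by
  have hx1 : ‖x‖ = 1 := hx ▸ norm_unitCoord hS (hT 0)
  have hy1 : ‖y‖ = 1 := hy ▸ norm_unitCoord hS (hT 1)
  have hw1 : ‖w‖ = 1 := hw ▸ norm_unitCoord hS (hT 2)
  have hlt := norm_sum_unitCoord_sq_lt_one hS hT hacute
  rw [hx, hy, hw] at hlt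
  have hK1 := norm_eq_one_of_mul_eq hx1 hy1 hw1 h0 hK
  have hK0 := ne_zero_of_norm_eq_one hK1
  have hR : (S.radius : ℂ) ≠ 0 := by exact_mod_cast hS.ne'
  rw [IsFeuerbachPoint, h.insphere_eq hS hT hacute, h.ninePointCircle_eq hS hT hacute hx hy hw hK]
  have hHpos : 0 < ‖x + y + w‖ ^ 2 := by
    have := norm_pos_iff.2 h0
    positivity
  set H : ℝ := ‖x + y + w‖ ^ 2 with hH
  have hH1 : 0 < 1 - H := by linarith
  have hH1' : (1 - H : ℂ) ≠ 0 := by exact_mod_cast hH1.ne'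
  refine ⟨fun heq ↦ ?_, ?_, ?_, ?_⟩
  · have := congrArg Sphere.radius heq
    simp only at this
    rw [eq_div_iff hH1.ne'] at this
    nlinarith
  · rw [mem_sphere, dist_eq_norm, add_sub_cancel_left, norm_mul, hK1, Complex.norm_real,
      Real.norm_of_nonneg hS.le, mul_one]
  · rw [mem_sphere, dist_eq_norm]
    simp only
    rw [show S.center + S.radius * K - (S.center - S.radius * ((H / (1 - H) : ℝ) * K)) =
      ((S.radius / (1 - H) : ℝ) : ℂ) * K by push_cast; field_simp; ring, norm_mul, hK1,
      Complex.norm_real, Real.norm_of_nonneg (by positivity), mul_one]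
  -- `H` is the parameter of the incentre on the segment from the nine-point centre to the contact
  -- point.
  · refine ⟨H, ⟨hHpos.le, hlt.le⟩, ?_⟩
    rw [AffineMap.lineMap_apply]
    simp only [vsub_eq_sub, vadd_eq_add, Complex.real_smul]
    push_cast
    field_simp
    ring

theorem x110_eq (hS : 0 < S.radius) (hT : ∀ i, T.points i ∈ S) {x y w K : ℂ}
    (hx : unitCoord S (T.points 0) = x) (hy : unitCoord S (T.points 1) = y)
    (hw : unitCoord S (T.points 2) = w) (h0 : x + y + w ≠ 0)
    (hK : K * (x + y + w) = x * y + y * w + w * x) :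
    x110 T = S.center + S.radius * K := by
  have hx1 : ‖x‖ = 1 := hx ▸ norm_unitCoord hS (hT 0)
  have hy1 : ‖y‖ = 1 := hy ▸ norm_unitCoord hS (hT 1)
  have hw1 : ‖w‖ = 1 := hw ▸ norm_unitCoord hS (hT 2)
  have hR : (S.radius : ℂ) ≠ 0 := by exact_mod_cast hS.ne'
  have hne : ∀ {i j : Fin 3}, i ≠ j →
      unitCoord S (T.points i) ≠ unitCoord S (T.points j) := fun h ↦
    (unitCoord_injective hS).ne (T.independent.injective.ne h)
  have hxy : x ≠ y := by rw [← hx, ← hy]; exact hne (by decide)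
  have hyw : y ≠ w := by rw [← hy, ← hw]; exact hne (by decide)
  have hwx : w ≠ x := by rw [← hw, ← hx]; exact hne (by decide)
  obtain ⟨a, ha⟩ : ∃ a, a = ‖y - w‖ := ⟨_, rfl⟩
  obtain ⟨b, hb⟩ : ∃ b, b = ‖w - x‖ := ⟨_, rfl⟩
  obtain ⟨c, hc⟩ : ∃ c, c = ‖x - y‖ := ⟨_, rfl⟩
  have hs := x110_weights_sum hx1 hy1 hw1 ha hb hc
  have hv := x110_weighted_sum hx1 hy1 hw1 ha hb hc
  have ha0 : a ≠ 0 := by rw [ha]; exact norm_ne_zero_iff.2 (sub_ne_zero.2 hyw)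
  have hb0 : b ≠ 0 := by rw [hb]; exact norm_ne_zero_iff.2 (sub_ne_zero.2 hwx)
  have hc0 : c ≠ 0 := by rw [hc]; exact norm_ne_zero_iff.2 (sub_ne_zero.2 hxy)
  have hh0 : ‖x + y + w‖ ≠ 0 := norm_ne_zero_iff.2 h0
  have hσ : a ^ 2 * b ^ 2 * c ^ 2 * ‖x + y + w‖ ^ 2 ≠ 0 := by positivity
  set σ : ℝ := a ^ 2 * b ^ 2 * c ^ 2 * ‖x + y + w‖ ^ 2 with hσ'
  have hσc : (σ : ℂ) ≠ 0 := by exact_mod_cast hσ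
  have e0 := sub_center_eq hS (T.points 0)
  have e1 := sub_center_eq hS (T.points 1)
  have e2 := sub_center_eq hS (T.points 2)
  rw [hx] at e0
  rw [hy] at e1
  rw [hw] at e2
  have hsc := congrArg (fun r : ℝ ↦ (r : ℂ)) hs
  simp only [x110, dist_eq_mul_norm_unitCoord_sub hS, hx, hy, hw, ← ha, ← hb, ← hc]
  rw [← hK] at hv
  have hv' := mul_left_cancel₀ h0 (hv.trans (by ring :
    _ = (x + y + w) * (-(K * (σ : ℂ)))))
  push_cast at hsc hv' ⊢
  rw [show T.points 0 = S.center + S.radius * x by linear_combination e0,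
    show T.points 1 = S.center + S.radius * y by linear_combination e1,
    show T.points 2 = S.center + S.radius * w by linear_combination e2]
  rw [div_eq_iff]
  -- The weights have degree 6 in the lengths, and the position relative to the centre adds one more
  -- factor of the radius.
  · linear_combination (S.radius : ℂ) ^ 7 * hv' - (S.radius : ℂ) ^ 7 * K * hsc
  · intro hzero
    have : (S.radius : ℂ) ^ 6 * -(σ : ℂ) = 0 := by
      linear_combination hzero - (S.radius : ℂ) ^ 6 * hsc
    exact (mul_ne_zero (pow_ne_zero 6 hR) (neg_ne_zero.2 hσc)) this

theorem IsTangentialTriangle.equilateral (hS : 0 < S.radius) (hT : ∀ i, T.points i ∈ S)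
    (hacute : T.AcuteAngled) (h : IsTangentialTriangle T T')
    (h0 : unitCoord S (T.points 0) + unitCoord S (T.points 1) + unitCoord S (T.points 2) = 0) :
    T'.Equilateral := by
  have hp := h.points_eq hS hT hacute
  set z : Fin 3 → ℂ := fun i ↦ unitCoord S (T.points i) with hz
  have hz1 : ∀ i, ‖z i‖ = 1 := fun i ↦ norm_unitCoord hS (hT i)
  have key : ∀ i, dist (T'.points i) (T'.points (i + 1)) = S.radius * (2 * √3) := by
    intro i
    have hsum : z i + z (i + 1) + z (i + 2) = 0 := by
      fin_cases i
      · exact h0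
      · exact (add_rotate _ _ _).symm.trans h0
      · exact (add_rotate _ _ _).trans h0
    obtain ⟨h1, h2⟩ := norm_chordPole_sub_of_sum_eq_zero (hz1 i) (hz1 (i + 1)) (hz1 (i + 2)) hsum
    rw [dist_eq_mul_norm_unitCoord_sub hS, hp, hp, tangentialVertex, tangentialVertex,
      show i + 1 + 1 = i + 2 by clear * -; decide +revert,
      show i + 1 + 2 = i by clear * -; decide +revert, h1, ← h2, Real.sqrt_sq (norm_nonneg _)]
  refine ⟨S.radius * (2 * √3), fun i j hij ↦ ?_⟩
  rcases eq_add_one_or_eq_add_two_of_ne hij with rfl | rfl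
  · exact key i
  · have := key (i + 2)
    rwa [add_two_add_one, dist_comm] at this

theorem sum_unitCoord_eq_zero_of_equilateral (hS : 0 < S.radius) (hT : ∀ i, T.points i ∈ S)
    (h : T.Equilateral) :
    unitCoord S (T.points 0) + unitCoord S (T.points 1) + unitCoord S (T.points 2) = 0 := by
  obtain ⟨r, hr⟩ := h
  have hne : ∀ {i j : Fin 3}, i ≠ j →
      unitCoord S (T.points i) ≠ unitCoord S (T.points j) := fun h ↦
    (unitCoord_injective hS).ne (T.independent.injective.ne h)
  have key : ∀ {i j : Fin 3}, i ≠ j →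
      ‖unitCoord S (T.points i) - unitCoord S (T.points j)‖ = r / S.radius := by
    intro i j hij
    rw [eq_div_iff hS.ne', mul_comm, ← dist_eq_mul_norm_unitCoord_sub hS, hr i j hij]
  exact sum_eq_zero_of_norm_sub_eq (norm_unitCoord hS (hT 0)) (norm_unitCoord hS (hT 1))
    (norm_unitCoord hS (hT 2)) (hne (by decide)) (hne (by decide)) (hne (by decide))
    ((key (by decide)).trans (key (by decide)).symm) ((key (by decide)).trans (key (by decide)).symm)

open ComplexConjugate in
/-- In the Poncelet family the orthocentre is an affine function of the product of the vertices. -/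
theorem sum_unitCoord_eq_of_mem_ponceletFamily (hS : 0 < S.radius) {f g : ℂ} {a : ℝ}
    (ha : dist f g < 2 * a) (hT : T ∈ ponceletFamily S (ellipse f g a)) {x y w : ℂ}
    (hx : unitCoord S (T.points 0) = x) (hy : unitCoord S (T.points 1) = y)
    (hw : unitCoord S (T.points 2) = w) :
    x + y + w = unitCoord S f + unitCoord S g +
      x * y * w * (conj (unitCoord S f) * conj (unitCoord S g)) := by
  obtain ⟨hTS, hTE⟩ := hT
  have hne : ∀ {i j : Fin 3}, i ≠ j → T.points i ≠ T.points j := fun h ↦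
    T.independent.injective.ne h
  -- The squared minor axis, measured in units of the radius.
  set κ : ℝ := ((2 * a) ^ 2 - dist f g ^ 2) / S.radius ^ 2 with hκ
  have key : ∀ {i j k : Fin 3}, i ≠ j → k + 1 = i → k + 2 = j →
      (unitCoord S f + unitCoord S (T.points i) * unitCoord S (T.points j) * conj (unitCoord S f) -
        unitCoord S (T.points i) - unitCoord S (T.points j)) *
      (unitCoord S g + unitCoord S (T.points i) * unitCoord S (T.points j) * conj (unitCoord S g) -
        unitCoord S (T.points i) - unitCoord S (T.points j)) =
      κ * (unitCoord S (T.points i) * unitCoord S (T.points j)) := by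
    rintro i j k hij rfl rfl
    have h1 := hTE k
    rw [sideline_eq] at h1
    have h2 := h1.im_mul_im_eq (hne hij) ha
    refine chord_tangency (norm_unitCoord hS (hTS _)) (norm_unitCoord hS (hTS _))
      ((unitCoord_injective hS).ne (hne hij)) ?_
    have him : ∀ p : ℂ, ((p - T.points (k + 1)) * conj (T.points (k + 2) - T.points (k + 1))).im =
        S.radius ^ 2 * ((unitCoord S p - unitCoord S (T.points (k + 1))) *
          conj (unitCoord S (T.points (k + 2)) - unitCoord S (T.points (k + 1)))).im := by
      intro p
      rw [← Complex.im_ofReal_mul, sub_eq_mul_unitCoord_sub hS p,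
        sub_eq_mul_unitCoord_sub hS (T.points (k + 2)), map_mul, Complex.conj_ofReal]
      congr 1
      push_cast
      ring
    rw [him, him, ← dist_eq_norm,
      dist_eq_mul_norm_unitCoord_sub hS (T.points (k + 2))] at h2
    have hR : S.radius ^ 2 ≠ 0 := by positivity
    rw [hκ, div_mul_eq_mul_div, eq_div_iff hR]
    refine mul_left_cancel₀ hR ?_
    linear_combination h2
  have h01 := key (i := 0) (j := 1) (k := 2) (by decide) (by decide) (by decide)
  have h12 := key (i := 1) (j := 2) (k := 0) (by decide) (by decide) (by decide)
  have h20 := key (i := 2) (j := 0) (k := 1) (by decide) (by decide) (by decide)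
  have hne' : ∀ {i j : Fin 3}, i ≠ j →
      unitCoord S (T.points i) ≠ unitCoord S (T.points j) := fun h ↦
    (unitCoord_injective hS).ne (hne h)
  subst hx hy hw
  exact sum_eq_of_chord_tangency (hne' (by decide)) (hne' (by decide)) (hne' (by decide)) h01
    (by linear_combination h20) h12

end Normalisation

/-! ### The main theorem -/

theorem mainTheorem6 (S : Sphere ℂ) (hS : 0 < S.radius)
    (f g : ℂ) (a : ℝ) (ha : dist f g < 2 * a)
    (hnested : ∀ z ∈ ellipse f g a, dist z S.center < S.radius)
    (hequi : ∃ T ∈ ponceletFamily S (ellipse f g a), T.Equilateral) :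
    -- the tangential family contains an equilateral triangle
    (∃ T ∈ ponceletFamily S (ellipse f g a),
      ∃ T', IsTangentialTriangle T T' ∧ T'.Equilateral) ∧
    -- if the center of the circle is inside the caustic, all members of the family are acute
    (dist S.center f + dist S.center g < 2 * a →
      ∀ T ∈ ponceletFamily S (ellipse f g a), T.AcuteAngled) ∧
    -- acute members have a tangential triangle, all of these circumscribe the circle `S`,
    -- and all of them, except equilateral ones, have the same Feuerbach point
    ∃ K ∈ S, ∀ T ∈ ponceletFamily S (ellipse f g a), T.AcuteAngled →
      (∃ T', IsTangentialTriangle T T') ∧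
      ∀ T', IsTangentialTriangle T T' →
        T'.insphere = S ∧
        (¬ T'.Equilateral → IsFeuerbachPoint T' K ∧ x110 T = K) := by
  obtain ⟨T₀, hT₀, he⟩ := hequi
  have hsum₀ := sum_unitCoord_eq_zero_of_equilateral hS hT₀.1 he
  refine ⟨?_, fun hc T hT ↦ acuteAngled_of_center_inside hnested hc hT, ?_⟩
  · obtain ⟨T', hT'⟩ := exists_isTangentialTriangle hS hT₀.1 he.acuteAngled
    exact ⟨T₀, hT₀, T', hT', hT'.equilateral hS hT₀.1 he.acuteAngled hsum₀⟩
  have hfg := sum_unitCoord_eq_of_mem_ponceletFamily hS ha hT₀ rfl rfl rfl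
  rw [hsum₀] at hfg
  set F := unitCoord S f
  set G := unitCoord S g
  set l₀ := unitCoord S (T₀.points 0) * unitCoord S (T₀.points 1) * unitCoord S (T₀.points 2)
    with hl₀
  have hl₀1 : ‖l₀‖ = 1 := by
    rw [hl₀, norm_mul, norm_mul, norm_unitCoord hS (hT₀.1 0), norm_unitCoord hS (hT₀.1 1),
      norm_unitCoord hS (hT₀.1 2)]
    norm_num
  have hl₀0 := ne_zero_of_norm_eq_one hl₀1
  obtain ⟨K, hK1, hK⟩ : ∃ K : ℂ, ‖K‖ = 1 ∧ K * (l₀ * (starRingEnd ℂ F * starRingEnd ℂ G)) = -(F * G) := by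
    by_cases hFG : F * G = 0
    -- Here e₁ = (e₃ - l₀)F̄Ḡ = 0 for every member, so all acute members have equilateral tangential
    -- triangles and any point of the circle will do.
    · refine ⟨1, norm_one, ?_⟩
      rw [← map_mul, hFG]
      simp
    · have hc0 : l₀ * (starRingEnd ℂ F * starRingEnd ℂ G) ≠ 0 := by
        rw [← map_mul]
        exact mul_ne_zero hl₀0 ((map_ne_zero _).2 hFG)
      refine ⟨-(F * G) / (l₀ * (starRingEnd ℂ F * starRingEnd ℂ G)), ?_, div_mul_cancel₀ _ hc0⟩
      rw [← map_mul, norm_div, norm_neg, norm_mul l₀, hl₀1, Complex.norm_conj, one_mul,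
        div_self (norm_ne_zero_iff.2 hFG)]
  refine ⟨S.center + S.radius * K, ?_, fun T hT hacute ↦
    ⟨exists_isTangentialTriangle hS hT.1 hacute, fun T' hT' ↦
      ⟨hT'.insphere_eq hS hT.1 hacute, fun hne ↦ ?_⟩⟩⟩
  · rw [mem_sphere, dist_eq_norm, add_sub_cancel_left, norm_mul, hK1, Complex.norm_real,
      Real.norm_of_nonneg hS.le, mul_one]
  obtain ⟨x, hx⟩ : ∃ x, unitCoord S (T.points 0) = x := ⟨_, rfl⟩
  obtain ⟨y, hy⟩ : ∃ y, unitCoord S (T.points 1) = y := ⟨_, rfl⟩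
  obtain ⟨w, hw⟩ : ∃ w, unitCoord S (T.points 2) = w := ⟨_, rfl⟩
  have hx1 : ‖x‖ = 1 := hx ▸ norm_unitCoord hS (hT.1 0)
  have hy1 : ‖y‖ = 1 := hy ▸ norm_unitCoord hS (hT.1 1)
  have hw1 : ‖w‖ = 1 := hw ▸ norm_unitCoord hS (hT.1 2)
  have h0 : x + y + w ≠ 0 := fun h ↦
    hne (hT'.equilateral hS hT.1 hacute (by rw [hx, hy, hw]; exact h))
  have hsum := sum_unitCoord_eq_of_mem_ponceletFamily hS ha hT hx hy hw
  have hKe : K * (x + y + w) = x * y + y * w + w * x := by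
    -- Comparison with the equilateral member removes F + G; the conjugate of this equation supplies
    -- e₂, and the unknown factor e₃ - l₀ cancels from the quotient.
    have h1 : x + y + w = (x * y * w - l₀) * (starRingEnd ℂ F * starRingEnd ℂ G) := by
      linear_combination hsum - hfg
    have h2 := conj_sum_eq hx1 hy1 hw1
    have hx0 := ne_zero_of_norm_eq_one hx1
    have hy0 := ne_zero_of_norm_eq_one hy1
    have hw0 := ne_zero_of_norm_eq_one hw1
    rw [h1] at h2
    simp only [map_mul, map_sub, Complex.conj_conj, conj_eq_inv_of_norm_eq_one hx1,
      conj_eq_inv_of_norm_eq_one hy1, conj_eq_inv_of_norm_eq_one hw1,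
      conj_eq_inv_of_norm_eq_one hl₀1] at h2
    rw [h1]
    refine mul_left_cancel₀ hl₀0 ?_
    field_simp at h2
    linear_combination (x * y * w - l₀) * hK + h2
  exact ⟨hT'.isFeuerbachPoint hS hT.1 hacute hx hy hw h0 hKe,
    x110_eq hS hT.1 hx hy hw h0 hKe⟩
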